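/- Let $b>1$, and let $\log$ denote the logarithm to base $b$. Let $\rho_1,\dots,\rho_n$ be quantum states on $\mathbb C^d$ (positive semidefinite complex $d\times d$ matrices of trace $1$) and let $\{p_i\}_{i=1}^n$ be a probability distribution. Write $H(\rho)=-\operatorname{tr}[\rho\log\rho]$ for the von Neumann entropy, $H(\{p_i\})=-\sum_i p_i\log p_i$ for the Shannon entropy (with $0\log 0=0$), $F(\rho,\sigma)=\|\sqrt\rho\sqrt\sigma\|_1$ for the fidelity, where $\|A\|_1=\operatorname{tr}\sqrt{A^*A}$, and $D(\rho\|\sigma)=\operatorname{tr}[\rho(\log\rho-\log\sigma)]$ for the quantum relative entropy if $\ker\sigma\subseteq\ker\rho$, and $D(\rho\|\sigma)=+\infty$ otherwise. Then \begin{align*} H\Big(\sum_{i=1}^n p_i\rho_i\Big)-\sum_{i=1}^n p_iH(\rho_i) &=H(\{p_i\})-D\Big(\sum_{i,j=1}^n\sqrt{p_ip_j}\,|i\rangle\langle j|\otimes\sqrt{\rho_i}\sqrt{\rho_j}\,\Big\|\,\sum_{i=1}^n p_i|i\rangle\langle i|\otimes\rho_i\Big)\\ &\ge H(\{p_i\})-\log\Big(1+2\sum_{1\le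 i<j\le n}\sqrt{p_ip_j}\,\operatorname{tr}[\sqrt{\rho_i}\sqrt{\rho_j}]\Big)\\ &\ge H(\{p_i\})-\log\Big(1+2\sum_{1\le i<j\le n}\sqrt{p_ip_j}\,F(\rho_i,\rho_j)\Big), \end{align*} where $|i\rangle$, $i=1,\dots,n$, is the standard basis of $\mathbb C^n$; in particular the relative entropy in the first line is finite. -/

import Mathlib

open scoped Kronecker MatrixOrder ComplexOrder

namespace QuantumInfo

/-- A quantum state (density matrix): positive semidefinite with unit trace. -/
structure IsState {m : Type*} [Fintype m] (ρ : Matrix m m ℂ) : Prop where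
  posSemidef : ρ.PosSemidef
  trace_eq_one : ρ.trace = 1

/-- The logarithm to base `b` of a Hermitian matrix, through its spectral decomposition.
As `Real.logb b 0 = 0`, it is the logarithm on the support, and `0` on the kernel, of a positive
semidefinite matrix; this is the convention `0 log 0 = 0`. -/
noncomputable def matrixLog {m : Type*} [Fintype m] [DecidableEq m] (b : ℝ)
    (A : Matrix m m ℂ) : Matrix m m ℂ :=
  cfc (Real.logb b) A

/-- The von Neumann entropy `- tr (ρ log ρ)`, in base `b`. -/
noncomputable def vonNeumannEntropy {m : Type*} [Fintype m] [DecidableEq m] (b : ℝ)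
    (ρ : Matrix m m ℂ) : ℝ :=
  -(ρ * matrixLog b ρ).trace.re

/-- The Shannon entropy `- ∑ i, p i log (p i)`, in base `b`. -/
noncomputable def shannonEntropy {ι : Type*} [Fintype ι] (b : ℝ) (p : ι → ℝ) : ℝ :=
  -∑ i, p i * Real.logb b (p i)

open Classical in
/-- The quantum relative entropy `D(ρ‖σ)`, in base `b`: it is `tr (ρ (log ρ - log σ))` if the
support of `ρ` is contained in that of `σ` (that is, `ker σ ⊆ ker ρ`), and `+∞` otherwise. -/
noncomputable def relativeEntropy {m : Type*} [Fintype m] [DecidableEq m] (b : ℝ)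
    (ρ σ : Matrix m m ℂ) : EReal :=
  if ∀ v : m → ℂ, σ.mulVec v = 0 → ρ.mulVec v = 0 then
    (((ρ * (matrixLog b ρ - matrixLog b σ)).trace.re : ℝ) : EReal)
  else ⊤

/-- The trace norm `‖A‖₁ = tr √(A* A)`. -/
noncomputable def traceNorm {m : Type*} [Fintype m] [DecidableEq m] (A : Matrix m m ℂ) : ℝ :=
  (CFC.abs A).trace.re

/-- The fidelity `F(ρ, σ) = ‖√ρ √σ‖₁`. -/
noncomputable def fidelity {m : Type*} [Fintype m] [DecidableEq m] (ρ σ : Matrix m m ℂ) : ℝ :=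
  traceNorm (CFC.sqrt ρ * CFC.sqrt σ)

end QuantumInfo

/-!
# A lower bound for the Holevo quantity

Put `T i = p i • ρ i`, `A i = √(T i)` and `B = ∑ i, T i`.

*Equality.* Let `K = ∑ i, |i⟩ ⊗ A i`. The first argument of the relative entropy is `K * Kᴴ`, and
`Kᴴ * K = B`, so `tr (K Kᴴ log (K Kᴴ)) = tr (B log B)`. The second argument is block diagonal with
blocks `T i`, which are also the diagonal blocks of `K * Kᴴ`, so the other term of the relative
entropy is `∑ i, tr (T i log (T i))`. Both facts come from `cfc_mul_eq_mul_cfc`: the functional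
calculus respects intertwining matrices. They give `relativeEntropy_block`, and
`re_trace_mul_matrixLog_smul` splits off the Shannon entropy.

*First inequality.* It remains to bound `D = tr (B log B) - ∑ i, tr (T i log (T i))` by
`log tr (∑ i, A i)²`. The joint spectral weights of `B` and the `T i`
(`exists_weights_trace_cfc_mul_cfc`) define a probability distribution `q` on pairs consisting of an
eigenvalue `lam` of `B` and an eigenvalue `s` of some `T i`, for which `D = E_q log (lam / s)`. By
concavity of the logarithm, `D ≤ 2 log E_q √(lam / s) = 2 log tr (√B * ∑ i, A i)`, and the
Cauchy-Schwarz inequality with `tr B = 1` gives `tr (√B * ∑ i, A i)² ≤ tr (∑ i, A i)²`.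

*Second inequality.* The logarithm is monotone, and `Re tr X ≤ ‖X‖₁` (`re_trace_le_traceNorm`).
-/

namespace QuantumInfo

variable {m ι : Type*} [Fintype m] [DecidableEq m] [Fintype ι]

/-! ### Functional calculus of Hermitian matrices -/

/-- A matrix that intertwines two Hermitian matrices intertwines their functional calculi, because
on the two finite spectra `f` agrees with one interpolation polynomial. -/
theorem cfc_mul_eq_mul_cfc {k : Type*} [Fintype k] [DecidableEq k] {A : Matrix m m ℂ}
    {B : Matrix k k ℂ} (hA : A.IsHermitian) (hB : B.IsHermitian) {K : Matrix m k ℂ}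
    (h : A * K = K * B) (f : ℝ → ℝ) :
    cfc f A * K = K * cfc f B := by
  classical
  set s : Finset ℝ := (A.finite_real_spectrum.union B.finite_real_spectrum).toFinset with hs
  set q : Polynomial ℝ := Lagrange.interpolate s id f with hq
  have hqs : ∀ x ∈ s, q.eval x = f x := fun x hx =>
    Lagrange.eval_interpolate_at_node f Function.injective_id.injOn hx
  have hfA : cfc f A = Polynomial.aeval A q := by
    rw [← cfc_polynomial q A hA.isSelfAdjoint]
    exact cfc_congr fun x hx => (hqs x (by simp [hs, hx])).symm
  have hfB : cfc f B = Polynomial.aeval B q := by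
    rw [← cfc_polynomial q B hB.isSelfAdjoint]
    exact cfc_congr fun x hx => (hqs x (by simp [hs, hx])).symm
  have hpow : ∀ j : ℕ, A ^ j * K = K * B ^ j := by
    intro j
    induction j with
    | zero => simp
    | succ j ih => rw [pow_succ, Matrix.mul_assoc, h, ← Matrix.mul_assoc, ih, Matrix.mul_assoc,
        ← pow_succ]
  rw [hfA, hfB, Polynomial.aeval_eq_sum_range, Polynomial.aeval_eq_sum_range, Matrix.sum_mul,
    Matrix.mul_sum]
  exact Finset.sum_congr rfl fun j _ => by rw [Matrix.smul_mul, Matrix.mul_smul, hpow]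

theorem mul_cfc_self_eq_cfc {A : Matrix m m ℂ} (hA : A.IsHermitian) (f : ℝ → ℝ) :
    A * cfc f A = cfc (fun x => x * f x) A := by
  have hc : ∀ g : ℝ → ℝ, ContinuousOn g (spectrum ℝ A) := fun g =>
    A.finite_real_spectrum.continuousOn g
  rw [cfc_mul (fun x => x) f A (hc _) (hc _), cfc_id' ℝ A hA.isSelfAdjoint]

/-- The joint spectral weights of two Hermitian matrices: with eigenvectors `u i` of `A` and `v j`
of `B`, `w i j = |⟨u i, v j⟩|²` turns `tr (f(A) g(B))` into a double sum over the eigenvalues. -/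
theorem exists_weights_trace_cfc_mul_cfc {A B : Matrix m m ℂ} (hA : A.IsHermitian)
    (hB : B.IsHermitian) : ∃ w : m → m → ℝ, (∀ i j, 0 ≤ w i j) ∧ ∀ f g : ℝ → ℝ,
      (cfc f A * cfc g B).trace.re
        = ∑ i, ∑ j, f (hA.eigenvalues i) * g (hB.eigenvalues j) * w i j := by
  set U : Matrix m m ℂ := hA.eigenvectorUnitary.1
  set V : Matrix m m ℂ := hB.eigenvectorUnitary.1
  refine ⟨fun i j => Complex.normSq ((star U * V) i j), fun i j => Complex.normSq_nonneg _, ?_⟩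
  intro f g
  have key : (cfc f A * cfc g B).trace = (Matrix.diagonal (fun i => (f (hA.eigenvalues i) : ℂ)) *
      ((star U * V) * Matrix.diagonal (fun i => (g (hB.eigenvalues i) : ℂ)) *
        star (star U * V))).trace := by
    rw [hA.cfc_eq, hB.cfc_eq, Matrix.IsHermitian.cfc, Matrix.IsHermitian.cfc,
      Unitary.conjStarAlgAut_apply, Unitary.conjStarAlgAut_apply]
    simp only [Matrix.mul_assoc]
    rw [Matrix.trace_mul_comm]
    simp only [star_mul, star_star, Matrix.mul_assoc]
    rfl
  rw [key, Matrix.trace]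
  simp only [Matrix.diag_apply, Matrix.diagonal_mul, Matrix.mul_apply (N := star (star U * V)),
    Matrix.mul_diagonal, Matrix.star_apply, Complex.re_sum, Finset.mul_sum]
  refine Finset.sum_congr rfl fun i _ => Finset.sum_congr rfl fun j _ => ?_
  have : (f (hA.eigenvalues i) : ℂ) * ((star U * V) i j * (g (hB.eigenvalues j) : ℂ) *
      star ((star U * V) i j)) = ((f (hA.eigenvalues i) * g (hB.eigenvalues j) *
        Complex.normSq ((star U * V) i j) : ℝ) : ℂ) := by
    push_cast
    rw [Complex.normSq_eq_conj_mul_self]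
    simp only [← starRingEnd_apply]
    ring
  rw [this, Complex.ofReal_re]

theorem sqrt_eq_cfc_sqrt {A : Matrix m m ℂ} (hA : A.PosSemidef) :
    CFC.sqrt A = cfc Real.sqrt A := by
  rw [CFC.sqrt_eq_real_sqrt A (Matrix.nonneg_iff_posSemidef.mpr hA), cfcₙ_eq_cfc]

theorem sqrt_smul_eq {ρ : Matrix m m ℂ} (hρ : ρ.PosSemidef) {p : ℝ} (hp : 0 ≤ p) :
    CFC.sqrt ((p : ℂ) • ρ) = (√p : ℂ) • CFC.sqrt ρ := by
  have h0 : 0 ≤ CFC.sqrt ρ := CFC.sqrt_nonneg ρ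
  refine CFC.sqrt_unique ?_ ?_
  · rw [Matrix.smul_mul, Matrix.mul_smul, smul_smul,
      CFC.sqrt_mul_sqrt_self ρ (Matrix.nonneg_iff_posSemidef.mpr hρ), ← Complex.ofReal_mul,
      Real.mul_self_sqrt hp]
  · rw [Matrix.nonneg_iff_posSemidef] at h0 ⊢
    exact h0.smul (by exact_mod_cast Real.sqrt_nonneg p)

theorem re_trace_sqrt_mul_sqrt_nonneg {A B : Matrix m m ℂ} (hA : A.PosSemidef)
    (hB : B.PosSemidef) : 0 ≤ (CFC.sqrt A * CFC.sqrt B).trace.re := by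
  obtain ⟨w, hw, h⟩ := exists_weights_trace_cfc_mul_cfc hA.1 hB.1
  rw [sqrt_eq_cfc_sqrt hA, sqrt_eq_cfc_sqrt hB, h]
  exact Finset.sum_nonneg fun i _ => Finset.sum_nonneg fun j _ =>
    mul_nonneg (mul_nonneg (Real.sqrt_nonneg _) (Real.sqrt_nonneg _)) (hw i j)

/-! ### Trace inequalities -/

/-- In an eigenbasis of `|A|` the diagonal entries of `A` are at most the eigenvalues of `|A|`: since
`star A * A = |A|²`, the `i`-th column of `A` in that basis has the `i`-th eigenvalue as its norm. -/
theorem re_trace_le_traceNorm (A : Matrix m m ℂ) : A.trace.re ≤ traceNorm A := by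
  have hP : (CFC.abs A).PosSemidef := Matrix.nonneg_iff_posSemidef.mp (CFC.abs_nonneg A)
  set U : Matrix m m ℂ := hP.1.eigenvectorUnitary.1 with hU
  have hUU : U * star U = 1 := Unitary.coe_mul_star_self _
  have hUU' : star U * U = 1 := Unitary.coe_star_mul_self _
  set D : Matrix m m ℂ := Matrix.diagonal (fun i => (hP.1.eigenvalues i : ℂ)) with hD
  have hspec : CFC.abs A = U * D * star U := by
    conv_lhs => rw [hP.1.spectral_theorem, Unitary.conjStarAlgAut_apply]
    rfl
  set M : Matrix m m ℂ := star U * A * U with hM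
  have hMM : star M * M = D * D := by
    have h1 : star M * M = star U * (star A * A) * U := by
      simp only [hM, star_mul, star_star, Matrix.mul_assoc]
      rw [← Matrix.mul_assoc U (star U), hUU, Matrix.one_mul]
    rw [h1, ← CFC.abs_mul_abs, hspec]
    simp only [Matrix.mul_assoc]
    rw [← Matrix.mul_assoc (star U) U, hUU', Matrix.mul_one, Matrix.one_mul,
      ← Matrix.mul_assoc (star U) U, hUU', Matrix.one_mul]
  have htr : A.trace = M.trace := by
    rw [hM, Matrix.trace_mul_comm, ← Matrix.mul_assoc, hUU, Matrix.one_mul]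
  have hdiag : ∀ i, (M i i).re ≤ hP.1.eigenvalues i := by
    intro i
    have h1 := congrFun (congrFun hMM i) i
    rw [hD, Matrix.diagonal_mul_diagonal, Matrix.diagonal_apply_eq, Matrix.mul_apply] at h1
    have h2 : ∑ j, Complex.normSq (M j i) = hP.1.eigenvalues i * hP.1.eigenvalues i := by
      have : ((∑ j, Complex.normSq (M j i) : ℝ) : ℂ)
          = ((hP.1.eigenvalues i * hP.1.eigenvalues i : ℝ) : ℂ) := by
        push_cast
        rw [← h1]
        exact Finset.sum_congr rfl fun j _ => Complex.normSq_eq_conj_mul_self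
      exact_mod_cast this
    have h3 : Complex.normSq (M i i) ≤ hP.1.eigenvalues i * hP.1.eigenvalues i := by
      rw [← h2]
      exact Finset.single_le_sum (f := fun j => Complex.normSq (M j i))
        (fun j _ => Complex.normSq_nonneg _) (Finset.mem_univ i)
    have h4 := hP.eigenvalues_nonneg i
    rw [Complex.normSq_apply] at h3
    nlinarith [mul_self_nonneg (M i i).im]
  rw [traceNorm, hP.1.trace_eq_sum_eigenvalues, htr, Matrix.trace, Complex.re_sum, Complex.re_sum]
  exact Finset.sum_le_sum fun i _ => hdiag i

/-- The Cauchy-Schwarz inequality for the Hilbert-Schmidt inner product, with `X` normalized. -/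
theorem re_trace_mul_le_of_trace_sq {m : Type*} [Fintype m] {X Y : Matrix m m ℂ}
    (hX : X.IsHermitian) (hY : Y.IsHermitian) (hX1 : (X * X).trace = 1) :
    (X * Y).trace.re ≤ √((Y * Y).trace.re) := by
  apply Real.le_sqrt_of_sq_le
  set t := (X * Y).trace.re
  -- `tr (Y - t X)² = tr Y² - t²` when `t = Re tr (X Y)`.
  have h := (Matrix.posSemidef_conjTranspose_mul_self (Y - (t : ℂ) • X)).trace_nonneg
  have h' := (Complex.le_def.mp h).1
  rw [Matrix.conjTranspose_sub, Matrix.conjTranspose_smul, hX.eq, hY.eq, Matrix.sub_mul,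
    Matrix.mul_sub, Matrix.mul_sub] at h'
  simp only [Matrix.smul_mul, Matrix.mul_smul, Matrix.trace_sub, Matrix.trace_smul, hX1,
    Matrix.trace_mul_comm Y X, smul_eq_mul, Complex.star_def, Complex.conj_ofReal,
    Complex.sub_re, Complex.re_ofReal_mul, Complex.zero_re, Complex.one_re] at h'
  change 0 ≤ _ - t * t - (t * t - t * (t * 1)) at h'
  nlinarith

/-! ### Entropies of weighted states -/

/-- The scalar `p` may be zero, in which case both sides are `0`. -/
theorem re_trace_mul_matrixLog_smul {b : ℝ} {ρ : Matrix m m ℂ} (hρ : IsState ρ) (p : ℝ) :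
    (((p : ℂ) • ρ) * matrixLog b ((p : ℂ) • ρ)).trace.re
      = p * Real.logb b p - p * vonNeumannEntropy b ρ := by
  have hsa := hρ.posSemidef.1.isSelfAdjoint
  have hc : ∀ g : ℝ → ℝ, ContinuousOn g (spectrum ℝ ρ) := fun g =>
    ρ.finite_real_spectrum.continuousOn g
  have hpρ : (p : ℂ) • ρ = p • ρ := by ext; simp
  have hlog : ((p : ℂ) • ρ) * matrixLog b ((p : ℂ) • ρ)
      = (p * Real.logb b p) • ρ + p • (ρ * matrixLog b ρ) := by
    have h1 : cfc (Real.logb b) (p • ρ) = cfc (fun x => Real.logb b (p * x)) ρ :=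
      (cfc_comp_const_mul p (Real.logb b) ρ
        ((ρ.finite_real_spectrum.image _).continuousOn _) hsa).symm
    rw [hpρ, matrixLog, matrixLog, h1, Matrix.smul_mul, mul_cfc_self_eq_cfc hρ.posSemidef.1,
      mul_cfc_self_eq_cfc hρ.posSemidef.1, ← cfc_smul _ _ _ (hc _), ← cfc_smul _ _ _ (hc _)]
    conv_rhs => enter [1]; rw [← cfc_smul_id (R := ℝ) (p * Real.logb b p) ρ hsa]
    rw [← cfc_add _ _ _ (hc _) (hc _)]
    refine cfc_congr fun x _ => ?_
    simp only [smul_eq_mul]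
    -- For `x = 0` or `p = 0` both sides vanish, thanks to the factor `p * x`.
    rcases eq_or_ne x 0 with rfl | hx
    · simp
    rcases eq_or_ne p 0 with rfl | hp0
    · simp
    rw [Real.logb_mul hp0 hx]
    ring
  rw [hlog, Matrix.trace_add, Matrix.trace_smul, Matrix.trace_smul, hρ.trace_eq_one,
    vonNeumannEntropy]
  simp

/-- Let `q` be the joint distribution `q(x, (i, y)) = s i y * |⟨u x, v i y⟩|²` of the eigenvalues
`lam x` of `∑ i, T i` and `s i y` of `T i`. The left-hand side is the `q`-average of
`log (lam x / s i y)`, hence by Jensen's inequality at most `2 log (E_q √(lam x / s i y))`, and this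
expectation is `tr (√(∑ i, T i) * ∑ i, √(T i))`. Bounding the
expectation by `c` beforehand reduces Jensen's inequality to the termwise `log z ≤ z - 1`. -/
theorem re_trace_sub_entropies_le {b : ℝ} (hb : 1 < b) {T : ι → Matrix m m ℂ}
    (hT : ∀ i, (T i).PosSemidef) (htr : (∑ i, T i).trace = 1) {c : ℝ} (hc : 0 < c)
    (hcT : (cfc Real.sqrt (∑ i, T i) * ∑ i, cfc Real.sqrt (T i)).trace.re ≤ c) :
    ((∑ i, T i) * cfc (Real.logb b) (∑ i, T i)).trace.re
      - ∑ i, (T i * cfc (Real.logb b) (T i)).trace.re ≤ 2 * Real.logb b c := by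
  set B : Matrix m m ℂ := ∑ i, T i with hBdef
  have hB : B.PosSemidef := Matrix.posSemidef_sum _ fun i _ => hT i
  choose w hw hwtr using fun i => exists_weights_trace_cfc_mul_cfc hB.1 (hT i).1
  set lam := hB.1.eigenvalues
  set s := fun i => (hT i).1.eigenvalues with hs
  have hlam : ∀ x, 0 ≤ lam x := hB.eigenvalues_nonneg
  have hs0 : ∀ i y, 0 ≤ s i y := fun i => (hT i).eigenvalues_nonneg
  have honeB : cfc (fun _ : ℝ => (1 : ℝ)) B = 1 := cfc_const_one ℝ _ hB.1.isSelfAdjoint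
  have hid : ∀ i, cfc (fun x : ℝ => x) (T i) = T i := fun i =>
    cfc_id' ℝ _ (hT i).1.isSelfAdjoint
  -- `q i x y = s i y * w i x y` is a probability distribution; its marginal in `x` is `lam x`.
  have hmarg : ∀ f : ℝ → ℝ, (B * cfc f B).trace.re
      = ∑ i, ∑ x, ∑ y, f (lam x) * s i y * w i x y := by
    intro f
    have : (B * cfc f B).trace.re = ∑ i, (cfc f B * T i).trace.re := by
      rw [Matrix.trace_mul_comm, ← Complex.re_sum, ← Matrix.trace_sum, ← Matrix.mul_sum]
    rw [this]
    refine Finset.sum_congr rfl fun i _ => ?_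
    conv_lhs => rw [← hid i]
    exact hwtr i f (fun x => x)
  -- Its marginal in `(i, y)` is `s i y`.
  have hmarg' : ∀ i, (T i * cfc (Real.logb b) (T i)).trace.re
      = ∑ x, ∑ y, s i y * Real.logb b (s i y) * w i x y := by
    intro i
    rw [mul_cfc_self_eq_cfc (hT i).1, ← Matrix.one_mul (cfc _ (T i)), ← honeB, hwtr]
    simp [hs]
  have htot : ∑ i, ∑ x, ∑ y, s i y * w i x y = 1 := by
    have := hmarg (fun _ => 1)
    rw [honeB, Matrix.mul_one, htr] at this
    simpa using this.symm
  have hsq : ∑ i, ∑ x, ∑ y, √(lam x) * √(s i y) * w i x y ≤ c := by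
    refine le_trans (le_of_eq ?_) hcT
    rw [Matrix.mul_sum, Matrix.trace_sum, Complex.re_sum]
    exact Finset.sum_congr rfl fun i _ => (hwtr i _ _).symm
  -- Apply the marginal identity to the indicator function of `0`.
  have hker : ∀ i x y, lam x = 0 → s i y * w i x y = 0 := by
    have h0 := hmarg (fun t => if t = 0 then 1 else 0)
    rw [mul_cfc_self_eq_cfc hB.1] at h0
    have hz : (fun t : ℝ => t * (if t = 0 then 1 else 0)) = fun _ => 0 := by
      funext t; split_ifs with h <;> simp [h]
    have hnn : ∀ i x y, 0 ≤ (if lam x = 0 then (1 : ℝ) else 0) * s i y * w i x y := fun i x y =>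
      mul_nonneg (mul_nonneg (by split_ifs <;> norm_num) (hs0 i y)) (hw i x y)
    rw [hz, cfc_const_zero, Matrix.trace_zero, Complex.zero_re, eq_comm,
      Finset.sum_eq_zero_iff_of_nonneg fun i _ => Finset.sum_nonneg fun x _ =>
        Finset.sum_nonneg fun y _ => hnn i x y] at h0
    intro i x y hx
    have h1 := h0 i (Finset.mem_univ i)
    rw [Finset.sum_eq_zero_iff_of_nonneg fun x _ => Finset.sum_nonneg fun y _ => hnn i x y] at h1
    have h2 := h1 x (Finset.mem_univ x)
    rw [Finset.sum_eq_zero_iff_of_nonneg fun y _ => hnn i x y] at h2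
    simpa [hx] using h2 y (Finset.mem_univ y)
  have hlogb : 0 < Real.log b := Real.log_pos hb
  -- This is `log z ≤ z - 1` at `z = √(lam x / s i y) / c`, weighted by `q i x y`.
  have hterm : ∀ i x y, Real.logb b (lam x) * s i y * w i x y
      - s i y * Real.logb b (s i y) * w i x y ≤ 2 * (Real.logb b c * (s i y * w i x y)
        + (√(lam x) * √(s i y) * w i x y / c - s i y * w i x y) / Real.log b) := by
    intro i x y
    have hw' := hw i x y
    rcases eq_or_ne (s i y * w i x y) 0 with h0 | h0
    · have e : Real.logb b (lam x) * s i y * w i x y - s i y * Real.logb b (s i y) * w i x y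
          = (Real.logb b (lam x) - Real.logb b (s i y)) * (s i y * w i x y) := by ring
      rw [e, h0]
      simp only [mul_zero, zero_add, sub_zero]
      positivity
    · have hlx : 0 < lam x := (hlam x).lt_of_ne fun h => h0 (hker i x y h.symm)
      have hsy : 0 < s i y := (hs0 i y).lt_of_ne fun h => h0 (by rw [← h, zero_mul])
      have hl : Real.log (√(lam x) / √(s i y) / c) ≤ √(lam x) / √(s i y) / c - 1 :=
        Real.log_le_sub_one_of_pos (by positivity)
      have hl' : Real.log (√(lam x) / √(s i y) / c)
          = (Real.log (lam x) - Real.log (s i y)) / 2 - Real.log c := by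
        rw [Real.log_div (by positivity) hc.ne', Real.log_div (by positivity) (by positivity),
          Real.log_sqrt hlx.le, Real.log_sqrt hsy.le]
        ring
      rw [hl'] at hl
      have hr : √(lam x) * √(s i y) * w i x y / c
          = (√(lam x) / √(s i y) / c) * (s i y * w i x y) := by
        have : s i y = √(s i y) * √(s i y) := (Real.mul_self_sqrt hsy.le).symm
        have h5 : √(s i y) ≠ 0 := by positivity
        conv_rhs => rw [this]
        field_simp
        rw [Real.sqrt_sq (Real.sqrt_nonneg _)]
        ring
      rw [hr]
      simp only [Real.logb]
      have h6 : 0 ≤ s i y * w i x y := mul_nonneg hsy.le hw'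
      have := mul_le_mul_of_nonneg_right hl h6
      rw [← sub_nonneg]
      have e : 2 * (Real.log c / Real.log b * (s i y * w i x y)
          + ((√(lam x) / √(s i y) / c) * (s i y * w i x y) - s i y * w i x y) / Real.log b)
          - (Real.log (lam x) / Real.log b * s i y * w i x y
            - s i y * (Real.log (s i y) / Real.log b) * w i x y)
          = 2 * ((√(lam x) / √(s i y) / c - 1) * (s i y * w i x y)
            - ((Real.log (lam x) - Real.log (s i y)) / 2 - Real.log c) * (s i y * w i x y))
              / Real.log b := by
        field_simp
        ring
      rw [e]
      exact div_nonneg (mul_nonneg zero_le_two (sub_nonneg.mpr this)) hlogb.le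
  have hsum := Finset.sum_le_sum fun i (_ : i ∈ Finset.univ) =>
    Finset.sum_le_sum fun x (_ : x ∈ Finset.univ) =>
      Finset.sum_le_sum fun y (_ : y ∈ Finset.univ) => hterm i x y
  simp only [Finset.sum_sub_distrib, Finset.sum_add_distrib, ← Finset.mul_sum,
    ← Finset.sum_div] at hsum
  rw [hmarg, Finset.sum_congr rfl fun i _ => hmarg' i]
  have hdiv : (∑ i, ∑ x, ∑ y, √(lam x) * √(s i y) * w i x y) / c ≤ 1 :=
    (div_le_one hc).mpr hsq
  have hneg : ((∑ i, ∑ x, ∑ y, √(lam x) * √(s i y) * w i x y) / c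
      - ∑ i, ∑ x, ∑ y, s i y * w i x y) / Real.log b ≤ 0 :=
    div_nonpos_of_nonpos_of_nonneg (by rw [htot]; linarith) hlogb.le
  rw [htot] at hsum hneg
  linarith

/-- The Cauchy-Schwarz inequality removes the factor `√(∑ i, T i)`, whose square has trace one. -/
theorem re_trace_sub_entropies_le_logb {b : ℝ} (hb : 1 < b) {T : ι → Matrix m m ℂ}
    (hT : ∀ i, (T i).PosSemidef) (htr : (∑ i, T i).trace = 1)
    (hpos : 0 < ((∑ i, CFC.sqrt (T i)) * ∑ i, CFC.sqrt (T i)).trace.re) :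
    ((∑ i, T i) * matrixLog b (∑ i, T i)).trace.re - ∑ i, (T i * matrixLog b (T i)).trace.re
      ≤ Real.logb b ((∑ i, CFC.sqrt (T i)) * ∑ i, CFC.sqrt (T i)).trace.re := by
  have hB : (∑ i, T i).PosSemidef := Matrix.posSemidef_sum _ fun i _ => hT i
  have hsqrt : ∀ C : Matrix m m ℂ, (CFC.sqrt C).PosSemidef := fun C =>
    Matrix.nonneg_iff_posSemidef.mp (CFC.sqrt_nonneg C)
  have hcs : (cfc Real.sqrt (∑ i, T i) * ∑ i, cfc Real.sqrt (T i)).trace.re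
      ≤ √((∑ i, CFC.sqrt (T i)) * ∑ i, CFC.sqrt (T i)).trace.re := by
    simp only [← sqrt_eq_cfc_sqrt (hT _)]
    rw [← sqrt_eq_cfc_sqrt hB]
    refine re_trace_mul_le_of_trace_sq (hsqrt _).1
      (Matrix.posSemidef_sum _ fun i _ => hsqrt (T i)).1 ?_
    rw [CFC.sqrt_mul_sqrt_self _ (Matrix.nonneg_iff_posSemidef.mpr hB), htr]
  refine (re_trace_sub_entropies_le hb hT htr (Real.sqrt_pos.mpr hpos) hcs).trans_eq ?_
  rw [Real.logb, Real.logb, Real.log_sqrt hpos.le]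
  ring

/-! ### Relative entropy of block matrices -/

section Block

variable [DecidableEq ι]

/-- The matrix of the isometry `v ↦ |i⟩ ⊗ v` from `ℂ^m` onto the `i`-th block of `ℂ^ι ⊗ ℂ^m`. -/
def blockIncl {ι : Type*} [DecidableEq ι] (m : Type*) [DecidableEq m] (i : ι) :
    Matrix (ι × m) m ℂ :=
  Matrix.of fun x y => if x.1 = i ∧ x.2 = y then 1 else 0

theorem blockIncl_conjTranspose_mul (i j : ι) :
    (blockIncl m i).conjTranspose * blockIncl m j = if i = j then 1 else 0 := by
  ext x y
  rw [Matrix.mul_apply, Fintype.sum_prod_type]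
  by_cases hij : i = j
  · subst hij
    simp [blockIncl, Matrix.one_apply, ite_and, apply_ite]
    grind
  · simp [blockIncl, hij, ite_and, apply_ite]
    grind

theorem single_kronecker_eq {ι : Type*} [DecidableEq ι] (i j : ι) (X : Matrix m m ℂ) :
    Matrix.single i j (1 : ℂ) ⊗ₖ X
      = blockIncl m i * X * (blockIncl m j).conjTranspose := by
  ext ⟨a, x⟩ ⟨c, y⟩
  simp only [Matrix.mul_apply, blockIncl, Matrix.kroneckerMap_apply, Matrix.single_apply,
    Matrix.conjTranspose_apply, Matrix.of_apply, ite_and]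
  rcases eq_or_ne a i with rfl | ha
  · rcases eq_or_ne c j with rfl | hc
    · simp
    · simp [hc, hc.symm]
  · simp [ha, ha.symm]

/-- The matrix `∑ i, |i⟩ ⊗ A i`: the blocks `A i` stacked in one column. -/
noncomputable def blockCol (A : ι → Matrix m m ℂ) : Matrix (ι × m) m ℂ :=
  ∑ i, blockIncl m i * A i

theorem conjTranspose_blockCol_mul_blockIncl (A : ι → Matrix m m ℂ)
    (hA : ∀ i, (A i).IsHermitian) (j : ι) :
    (blockCol A).conjTranspose * blockIncl m j = A j := by
  simp only [blockCol, Matrix.conjTranspose_sum, Matrix.conjTranspose_mul, (hA _).eq,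
    Matrix.sum_mul, Matrix.mul_assoc, blockIncl_conjTranspose_mul]
  simp

theorem conjTranspose_blockCol_mul_blockCol (A : ι → Matrix m m ℂ)
    (hA : ∀ i, (A i).IsHermitian) :
    (blockCol A).conjTranspose * blockCol A = ∑ i, A i * A i := by
  conv_lhs => rw [blockCol.eq_def A, Matrix.mul_sum]
  rw [← blockCol]
  exact Finset.sum_congr rfl fun j _ => by
    rw [← Matrix.mul_assoc, conjTranspose_blockCol_mul_blockIncl A hA]

theorem sum_single_kronecker_mul (A : ι → Matrix m m ℂ) (hA : ∀ i, (A i).IsHermitian) :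
    ∑ i, ∑ j, Matrix.single i j (1 : ℂ) ⊗ₖ (A i * A j)
      = blockCol A * (blockCol A).conjTranspose := by
  simp only [blockCol, Matrix.conjTranspose_sum, Matrix.conjTranspose_mul, (hA _).eq,
    Matrix.sum_mul, Matrix.mul_sum, single_kronecker_eq, Matrix.mul_assoc]
  exact Finset.sum_comm

theorem sum_single_kronecker_mul_blockIncl (T : ι → Matrix m m ℂ) (j : ι) :
    (∑ i, Matrix.single i i (1 : ℂ) ⊗ₖ T i) * blockIncl m j = blockIncl m j * T j := by
  simp only [Matrix.sum_mul, single_kronecker_eq, Matrix.mul_assoc, blockIncl_conjTranspose_mul]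
  rw [Finset.sum_eq_single j (fun i _ hij => by simp [hij]) (by simp)]
  simp

theorem isHermitian_sum_single_kronecker {T : ι → Matrix m m ℂ} (hT : ∀ i, (T i).IsHermitian) :
    (∑ i, Matrix.single i i (1 : ℂ) ⊗ₖ T i).IsHermitian := by
  simp only [single_kronecker_eq]
  rw [Matrix.IsHermitian, Matrix.conjTranspose_sum]
  exact Finset.sum_congr rfl fun i _ =>
    (Matrix.isHermitian_mul_mul_conjTranspose (blockIncl m i) (hT i)).eq

/-- With `K = ∑ i, |i⟩ ⊗ A i`, the first argument is `K * Kᴴ`, with the same nonzero spectrum as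
`Kᴴ * K = ∑ i, A i * A i`; the second is block diagonal, so its logarithm only sees the diagonal
blocks of the first. -/
theorem relativeEntropy_block (b : ℝ) (A : ι → Matrix m m ℂ) (hA : ∀ i, (A i).IsHermitian) :
    relativeEntropy b (∑ i, ∑ j, Matrix.single i j (1 : ℂ) ⊗ₖ (A i * A j))
        (∑ i, Matrix.single i i (1 : ℂ) ⊗ₖ (A i * A i))
      = (((((∑ i, A i * A i) * matrixLog b (∑ i, A i * A i)).trace.re
          - ∑ i, (A i * A i * matrixLog b (A i * A i)).trace.re : ℝ)) : EReal) := by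
  have hAA : ∀ i, (A i * A i).IsHermitian := fun i => by
    rw [Matrix.IsHermitian, Matrix.conjTranspose_mul, (hA i).eq]
  have hσ := isHermitian_sum_single_kronecker hAA
  set σ := ∑ i, Matrix.single i i (1 : ℂ) ⊗ₖ (A i * A i) with hσdef
  rw [sum_single_kronecker_mul A hA]
  set K := blockCol A with hK
  have hKK : K.conjTranspose * K = ∑ i, A i * A i := conjTranspose_blockCol_mul_blockCol A hA
  have hKE : ∀ j, K.conjTranspose * blockIncl m j = A j :=
    conjTranspose_blockCol_mul_blockIncl A hA
  -- `σ v = 0` forces every `A i * A i` to kill the `i`-th block of `v`, hence `A i` does.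
  have hsupp : ∀ v : ι × m → ℂ, σ.mulVec v = 0 → (K * K.conjTranspose).mulVec v = 0 := by
    intro v hv
    have hi : ∀ i, (A i * (blockIncl m i).conjTranspose).mulVec v = 0 := by
      intro i
      have h1 : (blockIncl m i).conjTranspose * σ
          = (A i).conjTranspose * A i * (blockIncl m i).conjTranspose := by
        have := congrArg Matrix.conjTranspose
          (sum_single_kronecker_mul_blockIncl (fun i => A i * A i) i)
        rw [Matrix.conjTranspose_mul, Matrix.conjTranspose_mul, (hAA i).eq] at this
        rw [(hA i).eq, ← this, hσ.eq]
      have h2 : ((A i).conjTranspose * A i).mulVec ((blockIncl m i).conjTranspose.mulVec v)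
          = 0 := by
        rw [Matrix.mulVec_mulVec, ← h1, ← Matrix.mulVec_mulVec, hv, Matrix.mulVec_zero]
      rw [← Matrix.mulVec_mulVec]
      exact (Matrix.conjTranspose_mul_self_mulVec_eq_zero _ _).mp h2
    have h3 : K.conjTranspose = ∑ i, A i * (blockIncl m i).conjTranspose := by
      simp only [hK, blockCol, Matrix.conjTranspose_sum, Matrix.conjTranspose_mul, (hA _).eq]
    rw [← Matrix.mulVec_mulVec, h3, Matrix.sum_mulVec, Finset.sum_eq_zero fun i _ => hi i,
      Matrix.mulVec_zero]
  rw [relativeEntropy, if_pos hsupp]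
  have hG : (K * K.conjTranspose).IsHermitian := Matrix.isHermitian_mul_conjTranspose_self K
  have hB : (K.conjTranspose * K).IsHermitian := Matrix.isHermitian_conjTranspose_mul_self K
  -- `K` intertwines `K * Kᴴ` and `Kᴴ * K`.
  have e1 : (K * K.conjTranspose * matrixLog b (K * K.conjTranspose)).trace
      = ((∑ i, A i * A i) * matrixLog b (∑ i, A i * A i)).trace := by
    have h := cfc_mul_eq_mul_cfc hG hB (K := K) (Matrix.mul_assoc _ _ _) (Real.logb b)
    rw [← hKK, matrixLog, matrixLog, Matrix.mul_assoc, Matrix.trace_mul_comm, Matrix.mul_assoc, h,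
      ← Matrix.mul_assoc]
  -- The `i`-th block inclusion intertwines `σ` and `A i * A i`.
  have e2 : (K * K.conjTranspose * matrixLog b σ).trace
      = ∑ i, (A i * A i * matrixLog b (A i * A i)).trace := by
    have h : ∀ i, cfc (Real.logb b) σ * blockIncl m i
        = blockIncl m i * cfc (Real.logb b) (A i * A i) := fun i =>
      cfc_mul_eq_mul_cfc hσ (hAA i)
        (sum_single_kronecker_mul_blockIncl (fun i => A i * A i) i) _
    have h' : cfc (Real.logb b) σ * K
        = ∑ i, blockIncl m i * (cfc (Real.logb b) (A i * A i) * A i) := by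
      rw [hK, blockCol, Matrix.mul_sum]
      exact Finset.sum_congr rfl fun i _ => by
        rw [← Matrix.mul_assoc, h, Matrix.mul_assoc]
    rw [matrixLog, Matrix.mul_assoc, Matrix.trace_mul_comm, Matrix.mul_assoc, h',
      Matrix.mul_sum, Matrix.trace_sum]
    refine Finset.sum_congr rfl fun i _ => ?_
    rw [← Matrix.mul_assoc, hKE, ← Matrix.mul_assoc, Matrix.trace_mul_comm, ← Matrix.mul_assoc,
      matrixLog]
  rw [Matrix.mul_sub, Matrix.trace_sub, Complex.sub_re, e1, e2, Complex.re_sum]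

end Block

/-! ### The bound -/

theorem sum_sum_eq_sum_diag_add_two_mul {n : ℕ} (g : Fin n → Fin n → ℝ)
    (hg : ∀ i j, g i j = g j i) :
    ∑ i, ∑ j, g i j = ∑ i, g i i + 2 * ∑ i, ∑ j ∈ Finset.Ioi i, g i j := by
  have hsplit : ∀ i, ∑ j, g i j
      = g i i + (∑ j ∈ Finset.Ioi i, g i j + ∑ j ∈ Finset.Iio i, g i j) := by
    intro i
    have hu : (Finset.univ : Finset (Fin n)) = insert i (Finset.Ioi i ∪ Finset.Iio i) := by
      ext j; simp; grind
    rw [hu, Finset.sum_insert (by simp), Finset.sum_union]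
    rw [Finset.disjoint_left]; intro j; simp; grind
  have hswap : ∑ i, ∑ j ∈ Finset.Iio i, g i j = ∑ i, ∑ j ∈ Finset.Ioi i, g i j := by
    rw [Finset.sum_comm' (t' := Finset.univ) (s' := fun j => Finset.Ioi j) (by simp)]
    exact Finset.sum_congr rfl fun i _ => Finset.sum_congr rfl fun j _ => hg j i
  rw [Finset.sum_congr rfl fun i _ => hsplit i, Finset.sum_add_distrib, Finset.sum_add_distrib,
    hswap]
  ring

end QuantumInfo


theorem mainTheorem3 (b : ℝ) (hb : 1 < b) (n d : ℕ)
    (ρ : Fin n → Matrix (Fin d) (Fin d) ℂ) (hρ : ∀ i, QuantumInfo.IsState (ρ i))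
    (p : Fin n → ℝ) (hp_nonneg : ∀ i, 0 ≤ p i) (hp_sum : ∑ i, p i = 1) :
    ((QuantumInfo.vonNeumannEntropy b (∑ i, (p i : ℂ) • ρ i)
          - ∑ i, p i * QuantumInfo.vonNeumannEntropy b (ρ i) : ℝ) : EReal)
        = (QuantumInfo.shannonEntropy b p : EReal)
          - QuantumInfo.relativeEntropy b
              (∑ i, ∑ j, (Real.sqrt (p i * p j) : ℂ) •
                ((Matrix.single i j (1 : ℂ)) ⊗ₖ (CFC.sqrt (ρ i) * CFC.sqrt (ρ j))))
              (∑ i, (p i : ℂ) • ((Matrix.single i i (1 : ℂ)) ⊗ₖ ρ i))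
    ∧ QuantumInfo.vonNeumannEntropy b (∑ i, (p i : ℂ) • ρ i)
          - ∑ i, p i * QuantumInfo.vonNeumannEntropy b (ρ i)
        ≥ QuantumInfo.shannonEntropy b p
          - Real.logb b (1 + 2 * ∑ i, ∑ j ∈ Finset.Ioi i,
              Real.sqrt (p i * p j) * (CFC.sqrt (ρ i) * CFC.sqrt (ρ j)).trace.re)
    ∧ QuantumInfo.shannonEntropy b p
          - Real.logb b (1 + 2 * ∑ i, ∑ j ∈ Finset.Ioi i,
              Real.sqrt (p i * p j) * (CFC.sqrt (ρ i) * CFC.sqrt (ρ j)).trace.re)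
        ≥ QuantumInfo.shannonEntropy b p
          - Real.logb b (1 + 2 * ∑ i, ∑ j ∈ Finset.Ioi i,
              Real.sqrt (p i * p j) * QuantumInfo.fidelity (ρ i) (ρ j)) := by
  open QuantumInfo in
  set T : Fin n → Matrix (Fin d) (Fin d) ℂ := fun i => (p i : ℂ) • ρ i with hTdef
  have hT : ∀ i, (T i).PosSemidef := fun i =>
    (hρ i).posSemidef.smul (by exact_mod_cast hp_nonneg i)
  set A : Fin n → Matrix (Fin d) (Fin d) ℂ := fun i => CFC.sqrt (T i) with hAdef
  have hA : ∀ i, (A i).IsHermitian := fun i =>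
    (Matrix.nonneg_iff_posSemidef.mp (CFC.sqrt_nonneg (T i))).1
  have hAs : ∀ i, A i = (√(p i) : ℂ) • CFC.sqrt (ρ i) := fun i =>
    sqrt_smul_eq (hρ i).posSemidef (hp_nonneg i)
  have hAA : ∀ i, A i * A i = T i := fun i =>
    CFC.sqrt_mul_sqrt_self _ (Matrix.nonneg_iff_posSemidef.mpr (hT i))
  have hAij : ∀ i j, A i * A j = (√(p i * p j) : ℂ) • (CFC.sqrt (ρ i) * CFC.sqrt (ρ j)) := by
    intro i j
    rw [hAs, hAs, Matrix.smul_mul, Matrix.mul_smul, smul_smul, ← Complex.ofReal_mul,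
      Real.sqrt_mul (hp_nonneg i)]
  have htr : (∑ i, T i).trace = 1 := by
    simp only [hTdef, Matrix.trace_sum, Matrix.trace_smul, (hρ _).trace_eq_one, smul_eq_mul,
      mul_one]
    exact_mod_cast hp_sum
  -- The Holevo quantity is expressed through the weighted states `T i = p i • ρ i`.
  have hTlog : ∑ i, (T i * matrixLog b (T i)).trace.re
      = -shannonEntropy b p - ∑ i, p i * vonNeumannEntropy b (ρ i) := by
    rw [shannonEntropy, neg_neg, ← Finset.sum_sub_distrib]
    exact Finset.sum_congr rfl fun i _ => re_trace_mul_matrixLog_smul (hρ i) (p i)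
  have hχ : vonNeumannEntropy b (∑ i, T i) - ∑ i, p i * vonNeumannEntropy b (ρ i)
      = shannonEntropy b p - (((∑ i, T i) * matrixLog b (∑ i, T i)).trace.re
        - ∑ i, (T i * matrixLog b (T i)).trace.re) := by
    rw [hTlog, vonNeumannEntropy]
    ring
  have hnn : ∀ i j, 0 ≤ √(p i * p j) * (CFC.sqrt (ρ i) * CFC.sqrt (ρ j)).trace.re := fun i j =>
    mul_nonneg (Real.sqrt_nonneg _)
      (re_trace_sqrt_mul_sqrt_nonneg (hρ i).posSemidef (hρ j).posSemidef)
  have hQnn : 0 ≤ ∑ i, ∑ j ∈ Finset.Ioi i,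
      √(p i * p j) * (CFC.sqrt (ρ i) * CFC.sqrt (ρ j)).trace.re :=
    Finset.sum_nonneg fun i _ => Finset.sum_nonneg fun j _ => hnn i j
  -- The argument of the logarithm is `tr (∑ i, √(T i))²`.
  have hQ : ((∑ i, A i) * ∑ i, A i).trace.re = 1 + 2 * ∑ i, ∑ j ∈ Finset.Ioi i,
      √(p i * p j) * (CFC.sqrt (ρ i) * CFC.sqrt (ρ j)).trace.re := by
    have hg : ∀ i j, (A i * A j).trace.re
        = √(p i * p j) * (CFC.sqrt (ρ i) * CFC.sqrt (ρ j)).trace.re := fun i j => by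
      rw [hAij, Matrix.trace_smul, smul_eq_mul, Complex.re_ofReal_mul]
    have hdiag : ∑ i, (A i * A i).trace.re = 1 := by
      rw [← Complex.re_sum, ← Matrix.trace_sum, Finset.sum_congr rfl fun i _ => hAA i, htr,
        Complex.one_re]
    simp only [← hg]
    rw [← hdiag, ← sum_sum_eq_sum_diag_add_two_mul (fun i j => (A i * A j).trace.re)
      fun i j => by rw [Matrix.trace_mul_comm], Matrix.sum_mul, Matrix.trace_sum, Complex.re_sum]
    exact Finset.sum_congr rfl fun i _ => by
      rw [Matrix.mul_sum, Matrix.trace_sum, Complex.re_sum]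
  refine ⟨?_, ?_, ?_⟩
  · have hG : ∑ i, ∑ j, (Real.sqrt (p i * p j) : ℂ) •
        ((Matrix.single i j (1 : ℂ)) ⊗ₖ (CFC.sqrt (ρ i) * CFC.sqrt (ρ j)))
        = ∑ i, ∑ j, Matrix.single i j (1 : ℂ) ⊗ₖ (A i * A j) :=
      Finset.sum_congr rfl fun i _ => Finset.sum_congr rfl fun j _ => by
        rw [hAij, Matrix.kronecker_smul]
    have hσ : ∑ i, (p i : ℂ) • ((Matrix.single i i (1 : ℂ)) ⊗ₖ ρ i)
        = ∑ i, Matrix.single i i (1 : ℂ) ⊗ₖ (A i * A i) :=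
      Finset.sum_congr rfl fun i _ => by rw [hAA, Matrix.kronecker_smul]
    rw [hG, hσ, relativeEntropy_block b A hA]
    simp only [hAA]
    rw [← EReal.coe_sub, hχ]
  · rw [hχ, ← hQ]
    refine sub_le_sub_left (re_trace_sub_entropies_le_logb hb hT htr ?_) _
    rw [hQ]
    linarith
  · have hle : ∑ i, ∑ j ∈ Finset.Ioi i,
        √(p i * p j) * (CFC.sqrt (ρ i) * CFC.sqrt (ρ j)).trace.re
        ≤ ∑ i, ∑ j ∈ Finset.Ioi i, √(p i * p j) * fidelity (ρ i) (ρ j) :=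
      Finset.sum_le_sum fun i _ => Finset.sum_le_sum fun j _ =>
        mul_le_mul_of_nonneg_left (re_trace_le_traceNorm _) (Real.sqrt_nonneg _)
    refine sub_le_sub_left (Real.logb_le_logb_of_le hb (by linarith) (by linarith)) _
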